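/- Let $F$ be an Archimedean (real) vector lattice, i.e. $\bigwedge_{n\ge 1}\frac1n f=0$ for every $f\in F_+$. A sublattice of $F$ is a linear subspace stable under the lattice operations. A sublattice $E\subset F$ is regular if for every nonempty $G\subset E$ whose infimum in the ordered set $E$ is $0$, the infimum of $G$ in $F$ is also $0$. For sublattices $E\subset H$ of $F$, $E$ is order dense in $H$ if for every $f\in H$ with $f>0$ there is $e\in E$ with $0<e\le f$. A net $(f_\alpha)$ in $F$ order converges to $f\in F$ if there is $G\subset F$ with $\bigwedge G=0$ such that for each $g\in G$ there is $\alpha_0$ with $|f_\alpha-f|\le g$ for all $\alpha\ge\alpha_0$; it uo-converges to $f$ if the net $(|a|\wedge|f_\alpha-f|)$ order converges to $0$ for every $a\in F$. The order (respectively uo-) adherence of a set $A\subset F$ is the set of all order (respectively uo-) limits in $F$ of nets in $A$, and $A$ is uo-closed if it equals its uo-adherence. Theorem. Let $E$ be a regular sublattice of $F$. Then the order adherence of $E$ is the largest regular sublattice of $F$ in which $E$ is order dense; that is, it is a regular sublattice of $F$ that contains $E$ as an order dense sublattice, and it contains every regular sublattice $H\supset E$ of $F$ in which $E$ is order dense.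 Moreover, the order adherence of $E$ equals the uo-adherence of $E$ and is uo-closed. -/

import Mathlib

/-
A (real) vector lattice is a type `F` with the instances
`[Lattice F] [AddCommGroup F] [IsOrderedAddMonoid F] [Module ℝ F] [IsOrderedModule ℝ F]`.
-/
universe u v

/-- A vector lattice is Archimedean if `⋀ₙ f / n = 0` for every positive `f`. -/
def IsArchimedeanVL (F : Type u) [Lattice F] [AddCommGroup F] [Module ℝ F] : Prop :=
  ∀ f : F, 0 ≤ f → IsGLB (Set.range fun n : ℕ => ((1 : ℝ) / ((n : ℝ) + 1)) • f) 0

/-- A linear subspace that is stable under the lattice operations of `F`. -/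
def IsVectorSublattice {F : Type u} [Lattice F] [AddCommGroup F] [Module ℝ F]
    (E : Submodule ℝ F) : Prop :=
  ∀ x ∈ E, ∀ y ∈ E, x ⊔ y ∈ E ∧ x ⊓ y ∈ E

/-- A sublattice `E` is regular if every nonempty `G ⊆ E` whose infimum in the ordered set `E`
is `0` has infimum `0` in `F` as well. -/
def IsRegularSublattice {F : Type u} [Lattice F] [AddCommGroup F] [Module ℝ F]
    (E : Submodule ℝ F) : Prop :=
  IsVectorSublattice E ∧
    ∀ G : Set E, G.Nonempty → IsGLB G (0 : E) → IsGLB ((fun e : E => (e : F)) '' G) (0 : F)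

/-- `E` is contained in `H`, and every interval `(0, f]` with `0 < f ∈ H` meets `E`. -/
def IsOrderDenseIn {F : Type u} [Lattice F] [AddCommGroup F] [Module ℝ F]
    (E H : Submodule ℝ F) : Prop :=
  E ≤ H ∧ ∀ f ∈ H, 0 < f → ∃ e ∈ E, 0 < e ∧ e ≤ f

/-- A net of positive elements converges in order to `0`: some set `G` with infimum `0` dominates
the tails of the net. -/
def OrderNull {F : Type u} [Lattice F] [AddCommGroup F] {ι : Type v} [Preorder ι]
    (p : ι → F) : Prop :=
  ∃ G : Set F, IsGLB G 0 ∧ ∀ g ∈ G, ∃ i₀ : ι, ∀ i, i₀ ≤ i → p i ≤ g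

/-- Order convergence of a net `x` to `f`. -/
def OrderConverges {F : Type u} [Lattice F] [AddCommGroup F] {ι : Type v} [Preorder ι]
    (x : ι → F) (f : F) : Prop :=
  OrderNull fun i => |x i - f|

/-- Unbounded order convergence of a net `x` to `f`. -/
def UOConverges {F : Type u} [Lattice F] [AddCommGroup F] {ι : Type v} [Preorder ι]
    (x : ι → F) (f : F) : Prop :=
  ∀ a : F, OrderNull fun i => |a| ⊓ |x i - f|

/-- The set of all order limits in `F` of nets in `A`. Index sets in the universe of `F` suffice:
a net may be replaced by the net of all pairs `(S, s)` with `s ∈ S`, where `S ⊆ A` contains a tail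
of it, ordered by reverse inclusion of `S`; this net has the same limits. -/
def orderAdherence {F : Type u} [Lattice F] [AddCommGroup F] (A : Set F) : Set F :=
  {f | ∃ (ι : Type u) (_ : Preorder ι) (_ : IsDirectedOrder ι) (_ : Nonempty ι) (x : ι → F),
    (∀ i, x i ∈ A) ∧ OrderConverges x f}

/-- The set of all unbounded order limits in `F` of nets in `A`. -/
def uoAdherence {F : Type u} [Lattice F] [AddCommGroup F] (A : Set F) : Set F :=
  {f | ∃ (ι : Type u) (_ : Preorder ι) (_ : IsDirectedOrder ι) (_ : Nonempty ι) (x : ι → F),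
    (∀ i, x i ∈ A) ∧ UOConverges x f}

/-- A set is uo-closed if it equals its uo-adherence. -/
def IsUOClosed {F : Type u} [Lattice F] [AddCommGroup F] (A : Set F) : Prop :=
  uoAdherence A = A

/-! Let U be the uo-adherence of E; it is a sublattice because the operations are Lipschitz. Two
facts carry the proof. (a) E is order dense in U (`IsRegularSublattice.exists_pos_le`), and U is
itself regular (`IsRegularSublattice.uoAdherenceSubmodule`). (b) If E is order dense in a regular
sublattice H, the Archimedean property makes every positive h in H the supremum in H of E ∩ [0, h].
Regularity carries this supremum to F, so h is an order limit from E, and H lies in the order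
adherence (`IsOrderDenseIn.subset_orderAdherence`). Applied to U, (b) identifies the two adherences;
applied to any competitor, it gives maximality; applied to the uo-adherence of U, it gives
closedness. -/

instance Prod.isDirectedOrder {ι κ : Type*} [Preorder ι] [Preorder κ] [IsDirectedOrder ι]
    [IsDirectedOrder κ] : IsDirectedOrder (ι × κ) :=
  ⟨fun x y => by
    obtain ⟨i, hi⟩ := exists_ge_ge x.1 y.1
    obtain ⟨j, hj⟩ := exists_ge_ge x.2 y.2
    exact ⟨(i, j), ⟨hi.1, hj.1⟩, ⟨hi.2, hj.2⟩⟩⟩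

/-! ### Order null nets. -/

section VectorLattice

variable {F : Type u} [Lattice F] [AddCommGroup F]

lemma OrderNull.mono {ι : Type v} [Preorder ι] {p q : ι → F}
    (hq : OrderNull q) (h : ∀ i, p i ≤ q i) : OrderNull p := by
  obtain ⟨G, hG, H⟩ := hq
  refine ⟨G, hG, fun g hg => ?_⟩
  obtain ⟨i₀, hi⟩ := H g hg
  exact ⟨i₀, fun i hi' => (h i).trans (hi i hi')⟩

lemma OrderNull.nonpos_of_forall_le {ι : Type v} [Preorder ι] {p : ι → F}
    (hp : OrderNull p) {f : F} (h : ∀ i, f ≤ p i) : f ≤ 0 := by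
  obtain ⟨G, hG, H⟩ := hp
  refine hG.2 fun g hg => ?_
  obtain ⟨i₀, hi⟩ := H g hg
  exact (h i₀).trans (hi i₀ le_rfl)

lemma orderAdherence_subset_uoAdherence (A : Set F) : orderAdherence A ⊆ uoAdherence A := by
  rintro f ⟨ι, _, _, _, x, hx, h⟩
  exact ⟨ι, _, ‹_›, ‹_›, x, hx, fun a => h.mono fun i => inf_le_right⟩

section Module

variable [Module ℝ F]

lemma OrderNull.smul [IsOrderedModule ℝ F] {ι : Type v} [Preorder ι] {p : ι → F}
    (hp : OrderNull p) {c : ℝ} (hc : 0 < c) : OrderNull fun i => c • p i := by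
  obtain ⟨A, hA, HA⟩ := hp
  refine ⟨(c • ·) '' A, ⟨?_, ?_⟩, ?_⟩
  · rintro _ ⟨a, ha, rfl⟩
    exact smul_nonneg hc.le (hA.1 ha)
  · intro l hl
    have : c⁻¹ • l ≤ 0 := hA.2 fun a ha => by
      have := smul_le_smul_of_nonneg_left (hl ⟨a, ha, rfl⟩) (inv_nonneg.mpr hc.le)
      simpa [smul_smul, inv_mul_cancel₀ hc.ne'] using this
    have := smul_le_smul_of_nonneg_left this hc.le
    simpa [smul_smul, mul_inv_cancel₀ hc.ne'] using this
  · rintro _ ⟨a, ha, rfl⟩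
    obtain ⟨i₀, hi⟩ := HA a ha
    exact ⟨i₀, fun i h => smul_le_smul_of_nonneg_left (hi i h) hc.le⟩

lemma IsVectorSublattice.abs_mem {E : Submodule ℝ F} (hE : IsVectorSublattice E) {x : F}
    (hx : x ∈ E) : |x| ∈ E :=
  (hE x hx (-x) (E.neg_mem hx)).1

lemma IsArchimedeanVL.nonpos_of_forall_nsmul_le [IsOrderedModule ℝ F] (hF : IsArchimedeanVL F) {e h : F} (h0 : 0 ≤ h)
    (he : ∀ n : ℕ, n • e ≤ h) : e ≤ 0 := by
  refine (hF h h0).2 ?_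
  rintro _ ⟨n, rfl⟩
  have hn : (0 : ℝ) < (n : ℝ) + 1 := by positivity
  have := smul_le_smul_of_nonneg_left (he (n + 1)) (one_div_pos.mpr hn).le
  rw [← Nat.cast_smul_eq_nsmul ℝ, smul_smul] at this
  push_cast at this
  rwa [one_div_mul_cancel hn.ne', one_smul] at this

lemma IsOrderDenseIn.trans {E H K : Submodule ℝ F} (h₁ : IsOrderDenseIn E H)
    (h₂ : IsOrderDenseIn H K) : IsOrderDenseIn E K := by
  refine ⟨h₁.1.trans h₂.1, fun f hf hpos => ?_⟩
  obtain ⟨g, hg, hg0, hgf⟩ := h₂.2 f hf hpos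
  obtain ⟨e, he, he0, heg⟩ := h₁.2 g hg hg0
  exact ⟨e, he, he0, heg.trans hgf⟩

end Module

variable [IsOrderedAddMonoid F]

lemma IsGLB.add_zero_zero {A B : Set F} (hA : IsGLB A 0) (hB : IsGLB B 0) :
    IsGLB (Set.image2 (· + ·) A B) 0 := by
  constructor
  · rintro _ ⟨a, ha, b, hb, rfl⟩
    exact add_nonneg (hA.1 ha) (hB.1 hb)
  · intro l hl
    refine hA.2 fun a ha => ?_
    refine sub_nonpos.mp (hB.2 fun b hb => ?_)
    exact sub_le_iff_le_add'.mpr (hl ⟨a, ha, b, hb, rfl⟩)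

lemma OrderNull.add_prod {ι κ : Type*} [Preorder ι] [Preorder κ] {p : ι → F} {q : κ → F}
    (hp : OrderNull p) (hq : OrderNull q) :
    OrderNull fun i : ι × κ => p i.1 + q i.2 := by
  obtain ⟨A, hA, HA⟩ := hp
  obtain ⟨B, hB, HB⟩ := hq
  refine ⟨_, hA.add_zero_zero hB, ?_⟩
  rintro _ ⟨a, ha, b, hb, rfl⟩
  obtain ⟨i₀, hi⟩ := HA a ha
  obtain ⟨j₀, hj⟩ := HB b hb
  exact ⟨(i₀, j₀), fun k hk => add_le_add (hi _ hk.1) (hj _ hk.2)⟩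

lemma inf_add_le_inf_add_inf {a s t : F} (ha : 0 ≤ a) (hs : 0 ≤ s) (ht : 0 ≤ t) :
    a ⊓ (s + t) ≤ a ⊓ s + a ⊓ t := by
  rw [inf_add, add_inf, add_inf]
  refine le_inf (le_inf ?_ ?_) (le_inf ?_ ?_)
  · exact inf_le_left.trans (le_add_of_nonneg_left ha)
  · exact inf_le_left.trans (le_add_of_nonneg_right ht)
  · exact inf_le_left.trans (le_add_of_nonneg_left hs)
  · exact inf_le_right

lemma subset_orderAdherence (A : Set F) : A ⊆ orderAdherence A := by
  intro f hf
  refine ⟨PUnit, inferInstance, inferInstance, inferInstance, fun _ => f, fun _ => hf, ?_⟩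
  exact ⟨{0}, isGLB_singleton, by simp⟩

/-- The Lipschitz bound passes through `|a| ⊓ ·` because that map is subadditive on positive
elements; the product index set lets the two nets run independently. -/
lemma map₂_mem_uoAdherence {A : Set F} (φ : F → F → F)
    (hφ : ∀ x y x' y', |φ x y - φ x' y'| ≤ |x - x'| + |y - y'|)
    (hA : ∀ x ∈ A, ∀ y ∈ A, φ x y ∈ A) {f g : F}
    (hf : f ∈ uoAdherence A) (hg : g ∈ uoAdherence A) : φ f g ∈ uoAdherence A := by
  obtain ⟨ι, _, _, _, x, hx, hxf⟩ := hf
  obtain ⟨κ, _, _, _, y, hy, hyg⟩ := hg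
  refine ⟨ι × κ, inferInstance, inferInstance, inferInstance, fun k => φ (x k.1) (y k.2),
    fun k => hA _ (hx _) _ (hy _), fun a => ?_⟩
  refine ((hxf a).add_prod (hyg a)).mono fun k => ?_
  exact (inf_le_inf_left _ (hφ _ _ _ _)).trans
    (inf_add_le_inf_add_inf (abs_nonneg _) (abs_nonneg _) (abs_nonneg _))

lemma abs_sup_sub_sup_le_add (x y x' y' : F) :
    |x ⊔ y - x' ⊔ y'| ≤ |x - x'| + |y - y'| := by
  have h : x ⊔ y - x' ⊔ y' = (x ⊔ y - x' ⊔ y) + (y ⊔ x' - y' ⊔ x') := by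
    rw [sup_comm y x', sup_comm y' x']; abel
  rw [h]
  exact (abs_add_le _ _).trans
    (add_le_add (abs_sup_sub_sup_le_abs _ _ _) (abs_sup_sub_sup_le_abs _ _ _))

lemma abs_inf_sub_inf_le_add (x y x' y' : F) :
    |x ⊓ y - x' ⊓ y'| ≤ |x - x'| + |y - y'| := by
  have h : x ⊓ y - x' ⊓ y' = (x ⊓ y - x' ⊓ y) + (y ⊓ x' - y' ⊓ x') := by
    rw [inf_comm y x', inf_comm y' x']; abel
  rw [h]
  exact (abs_add_le _ _).trans
    (add_le_add (abs_inf_sub_inf_le_abs _ _ _) (abs_inf_sub_inf_le_abs _ _ _))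

variable [Module ℝ F]

section Ordered

variable [IsOrderedModule ℝ F]

lemma smul_mem_uoAdherence {E : Submodule ℝ F} (c : ℝ) {f : F}
    (hf : f ∈ uoAdherence (E : Set F)) : c • f ∈ uoAdherence (E : Set F) := by
  obtain ⟨ι, _, _, _, x, hx, hxf⟩ := hf
  refine ⟨ι, inferInstance, inferInstance, inferInstance, fun i => c • x i,
    fun i => E.smul_mem c (hx i), fun a => ?_⟩
  -- The constant bounds `|c|` yet stays positive when `c = 0`, so it can be inverted; testing
  -- against `C⁻¹ • a` lets it factor out of both terms of the infimum.
  have hC : 0 < max 1 |c| := lt_max_of_lt_left one_pos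
  refine ((hxf ((max 1 |c|)⁻¹ • a)).smul hC).mono fun i => ?_
  have habs : ∀ (d : ℝ) (y : F), |d • y| ≤ |d| • |y| := by
    intro d y
    have key : ∀ (r : ℝ) (z : F), 0 ≤ r → |r • z| ≤ r • |z| := fun r z hr =>
      sup_le (smul_le_smul_of_nonneg_left (le_abs_self z) hr) (by
        rw [← smul_neg]; exact smul_le_smul_of_nonneg_left (neg_le_abs z) hr)
    rcases le_total 0 d with h | h
    · rw [abs_of_nonneg h]; exact key d y h
    · rw [abs_of_nonpos h, ← abs_neg (d • y), ← neg_smul]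
      exact key _ y (neg_nonneg.mpr h)
  set C := max 1 |c|
  have h₁ : C⁻¹ • (|a| ⊓ |c • x i - c • f|) ≤ |C⁻¹ • a| ⊓ |x i - f| := by
    refine le_inf ?_ ?_
    · have h : |a| ≤ C • |C⁻¹ • a| := by
        have := habs C (C⁻¹ • a)
        rwa [smul_smul, mul_inv_cancel₀ hC.ne', one_smul, abs_of_pos hC] at this
      have := smul_le_smul_of_nonneg_left (inf_le_left.trans h : |a| ⊓ |c • x i - c • f| ≤ _)
        (inv_nonneg.mpr hC.le)
      rwa [smul_smul C⁻¹ C, inv_mul_cancel₀ hC.ne', one_smul] at this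
    · have h : |c • x i - c • f| ≤ C • |x i - f| := by
        rw [← smul_sub]
        exact (habs _ _).trans (smul_le_smul_of_nonneg_right (le_max_right _ _) (abs_nonneg _))
      have := smul_le_smul_of_nonneg_left (inf_le_right.trans h : |a| ⊓ |c • x i - c • f| ≤ _)
        (inv_nonneg.mpr hC.le)
      rwa [smul_smul, inv_mul_cancel₀ hC.ne', one_smul] at this
  have := smul_le_smul_of_nonneg_left h₁ hC.le
  rwa [smul_smul, mul_inv_cancel₀ hC.ne', one_smul] at this

/-- The uo-adherence of a linear subspace, as a linear subspace. -/
def uoAdherenceSubmodule (E : Submodule ℝ F) : Submodule ℝ F where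
  carrier := uoAdherence (E : Set F)
  add_mem' := map₂_mem_uoAdherence (· + ·)
    (fun x y x' y' => by
      have : x + y - (x' + y') = (x - x') + (y - y') := by abel
      rw [this]; exact abs_add_le _ _)
    fun x hx y hy => E.add_mem hx hy
  zero_mem' := orderAdherence_subset_uoAdherence _ (subset_orderAdherence _ E.zero_mem)
  smul_mem' c _ hf := smul_mem_uoAdherence c hf

lemma le_uoAdherenceSubmodule (E : Submodule ℝ F) : E ≤ uoAdherenceSubmodule E :=
  fun _ hx => orderAdherence_subset_uoAdherence _ (subset_orderAdherence _ hx)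

lemma IsVectorSublattice.uoAdherenceSubmodule {E : Submodule ℝ F} (hE : IsVectorSublattice E) :
    IsVectorSublattice (uoAdherenceSubmodule E) := fun _ hx _ hy =>
  ⟨map₂_mem_uoAdherence (· ⊔ ·) abs_sup_sub_sup_le_add (fun x hx y hy => (hE x hx y hy).1) hx hy,
    map₂_mem_uoAdherence (· ⊓ ·) abs_inf_sub_inf_le_add (fun x hx y hy => (hE x hx y hy).2) hx hy⟩

end Ordered

/-! ### Order density in the uo-adherence. -/

/-- An element dominated by the uo-adherence of `E` vanishes when it is disjoint from `E`. -/
lemma nonpos_of_forall_inf_eq_zero {E : Submodule ℝ F} (hE : IsVectorSublattice E) {f b : F}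
    (hf : f ∈ uoAdherence (E : Set F)) (hb : 0 ≤ b) (hbf : b ≤ |f|)
    (h : ∀ e ∈ E, 0 ≤ e → b ⊓ e = 0) : b ≤ 0 := by
  obtain ⟨ι, _, _, _, x, hx, hxf⟩ := hf
  refine (hxf b).nonpos_of_forall_le fun i => ?_
  have h₁ : b ≤ |x i| + |x i - f| := by
    have h₂ : f = x i + -(x i - f) := by abel
    refine hbf.trans ?_
    conv_lhs => rw [h₂]
    exact (abs_add_le _ _).trans (by rw [abs_neg])
  calc b = b ⊓ (|x i| + |x i - f|) := (inf_eq_left.mpr h₁).symm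
    _ ≤ b ⊓ |x i| + b ⊓ |x i - f| := inf_add_le_inf_add_inf hb (abs_nonneg _) (abs_nonneg _)
    _ = |b| ⊓ |x i - f| := by
      rw [h _ (hE.abs_mem (hx i)) (abs_nonneg _), zero_add, abs_of_nonneg hb]

/-- A regular sublattice is order dense in its uo-adherence. -/
lemma IsRegularSublattice.exists_pos_le {E : Submodule ℝ F} (hE : IsRegularSublattice E) {f : F}
    (hf : f ∈ uoAdherence (E : Set F)) (hpos : 0 < f) : ∃ e ∈ E, 0 < e ∧ e ≤ f := by
  by_contra! hno
  obtain ⟨e, he, he0, hfe⟩ : ∃ e ∈ E, 0 ≤ e ∧ f ⊓ e ≠ 0 := by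
    by_contra! hc
    exact hpos.not_ge (nonpos_of_forall_inf_eq_zero hE.1 hf hpos.le (le_abs_self f) hc)
  obtain ⟨ι, _, _, _, x, hx, hxf⟩ := hf
  -- Truncation to `[0, e]` keeps the net in `E` and turns uo-convergence to `f` into order
  -- convergence to `f ⊓ e`.
  have hy0 : ∀ i, 0 ≤ (x i ⊔ 0) ⊓ e := fun i => le_inf le_sup_right he0
  have hnull : OrderNull fun i => |(x i ⊔ 0) ⊓ e - f ⊓ e| := by
    refine (hxf e).mono fun i => le_inf ?_ ?_
    · rw [abs_of_nonneg he0]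
      refine sup_le ?_ ?_
      · exact (sub_le_self _ (le_inf hpos.le he0)).trans inf_le_right
      · rw [neg_sub]
        exact (sub_le_self _ (hy0 i)).trans inf_le_right
    · have := abs_sup_sub_sup_le_abs (x i) f 0
      rw [sup_eq_left.mpr hpos.le] at this
      exact (abs_inf_sub_inf_le_abs _ _ _).trans this
  have hyE : ∀ i, (x i ⊔ 0) ⊓ e ∈ E := fun i =>
    (hE.1 _ (hE.1 _ (hx i) _ E.zero_mem).1 _ he).2
  obtain ⟨G, hG, H⟩ := hnull
  refine hfe (le_antisymm (hG.2 fun g hg => ?_) (le_inf hpos.le he0))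
  obtain ⟨i₀, hi₀⟩ := H g hg
  -- A lower bound of a tail in `E` stays below the limit once joined with 0, so by `hno` its
  -- positive part vanishes: the tail has infimum 0 in `E`, hence in `F`. But `f ⊓ e - g` bounds
  -- this tail from below, which forces `f ⊓ e ≤ g`.
  have hglb : IsGLB ((fun i => (⟨_, hyE i⟩ : E)) '' Set.Ici i₀) (0 : E) := by
    constructor
    · rintro _ ⟨i, -, rfl⟩
      exact hy0 i
    · rintro ⟨l, hlE⟩ hl
      have hl' : ∀ i, i₀ ≤ i → l ≤ (x i ⊔ 0) ⊓ e := fun i hi => hl ⟨i, hi, rfl⟩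
      have hle : l ⊔ 0 ≤ f ⊓ e := by
        refine sub_nonpos.mp (hG.2 fun g' hg' => ?_)
        obtain ⟨i₁, hi₁⟩ := H g' hg'
        obtain ⟨i, h0, h1⟩ := exists_ge_ge i₀ i₁
        exact (sub_le_sub_right (sup_le (hl' i h0) (hy0 i)) _).trans
          ((le_abs_self _).trans (hi₁ i h1))
      have hlE' : l ⊔ 0 ∈ E := (hE.1 _ hlE _ E.zero_mem).1
      have : l ⊔ 0 = 0 := by
        by_contra hne
        exact hno _ hlE' (lt_of_le_of_ne le_sup_right (Ne.symm hne)) (hle.trans inf_le_left)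
      exact le_sup_left.trans this.le
  have hglbF := hE.2 _ (Set.nonempty_Ici.image _) hglb
  refine sub_nonpos.mp (hglbF.2 ?_)
  rintro _ ⟨_, ⟨i, hi, rfl⟩, rfl⟩
  refine sub_le_comm.mp ?_
  refine (le_abs_self _).trans ?_
  rw [abs_sub_comm]
  exact hi₀ i hi

variable [IsOrderedModule ℝ F]

lemma IsRegularSublattice.isOrderDenseIn_uoAdherence {E : Submodule ℝ F}
    (hE : IsRegularSublattice E) : IsOrderDenseIn E (uoAdherenceSubmodule E) :=
  ⟨le_uoAdherenceSubmodule E, fun _ hf hpos => hE.exists_pos_le hf hpos⟩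

/-! ### Regularity of the uo-adherence, and order approximation from below. -/

/-- In an Archimedean vector lattice, every positive element of `H` is the supremum in `H` of the
elements of an order dense subspace below it. -/
lemma IsOrderDenseIn.le_of_forall_le (hF : IsArchimedeanVL F) {E H : Submodule ℝ F}
    (hH : IsVectorSublattice H) (hd : IsOrderDenseIn E H) {h u : F} (hh : h ∈ H) (h0 : 0 ≤ h)
    (hu : u ∈ H) (hub : ∀ e ∈ E, 0 ≤ e → e ≤ h → e ≤ u) : h ≤ u := by
  by_contra hc
  have hpos : 0 < h - u ⊓ h := by
    refine lt_of_le_of_ne (sub_nonneg.mpr inf_le_right) fun heq => hc ?_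
    rw [sub_eq_zero.mp heq.symm]
    exact inf_le_left
  obtain ⟨e, heE, he0, he⟩ := hd.2 _ (H.sub_mem hh (hH _ hu _ hh).2) hpos
  refine he0.not_ge (hF.nonpos_of_forall_nsmul_le h0 fun n => ?_)
  -- If `n • e ≤ h`, then `hub` gives `n • e ≤ u ⊓ h`, and adding `e ≤ h - u ⊓ h` gives the next
  -- multiple.
  induction n with
  | zero => simpa using h0
  | succ n ih =>
    have h₁ := hub _ (E.nsmul_mem heE n) (nsmul_nonneg he0.le n) ih
    rw [succ_nsmul]
    exact (add_le_add (le_inf h₁ ih) he).trans (by simp)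

/-- The uo-adherence of a regular sublattice is a regular sublattice. -/
lemma IsRegularSublattice.uoAdherenceSubmodule (hF : IsArchimedeanVL F) {E : Submodule ℝ F}
    (hE : IsRegularSublattice E) : IsRegularSublattice (uoAdherenceSubmodule E) := by
  have hU := hE.1.uoAdherenceSubmodule
  have hd := hE.isOrderDenseIn_uoAdherence
  refine ⟨hU, fun G ⟨g₀, hg₀⟩ hG => ⟨?_, fun b hb => ?_⟩⟩
  · rintro _ ⟨g, hg, rfl⟩
    exact hG.1 hg
  have hG0 : ∀ g ∈ G, (0 : F) ≤ g := fun g hg => hG.1 hg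
  have hbG : ∀ g ∈ G, b ⊔ 0 ≤ g := fun g hg => sup_le (hb ⟨g, hg, rfl⟩) (hG0 g hg)
  refine le_sup_left.trans (nonpos_of_forall_inf_eq_zero hE.1 g₀.2 le_sup_right
    ((hbG g₀ hg₀).trans (le_abs_self _)) fun e he he0 => ?_)
  refine le_antisymm ?_ (le_inf le_sup_right he0)
  -- Since `g ⊓ e` need not lie in `E`, it is replaced by its majorants in `E`, to which the
  -- regularity of `E` applies.
  have hglb : IsGLB {x : E | ∃ g ∈ G, (g : F) ⊓ e ≤ x} (0 : E) := by
    constructor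
    · rintro x ⟨g, hg, hx⟩
      exact (le_inf (hG0 g hg) he0).trans hx
    · rintro ⟨l, hlE⟩ hl
      refine hG.2 (show (⟨l, hd.1 hlE⟩ : _root_.uoAdherenceSubmodule E) ∈ lowerBounds G from
        fun g hg => ?_)
      have hgeU : e - (g : F) ⊓ e ∈ _root_.uoAdherenceSubmodule E :=
        Submodule.sub_mem _ (hd.1 he) (hU _ g.2 _ (hd.1 he)).2
      -- Each `x` in `E` with `0 ≤ x ≤ e - g ⊓ e` yields a majorant `e - x` of `g ⊓ e`, so `l ≤ e -
      -- x`. As such `x` have supremum `e - g ⊓ e`, it follows that `l ≤ g ⊓ e`.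
      have h₁ : e - (g : F) ⊓ e ≤ e - l :=
        hd.le_of_forall_le hF hU hgeU (sub_nonneg.mpr inf_le_right)
          (Submodule.sub_mem _ (hd.1 he) (hd.1 hlE)) fun x hx _ hxe =>
          le_sub_comm.mp (hl (a := ⟨e - x, E.sub_mem he hx⟩) ⟨g, hg, le_sub_comm.mp hxe⟩)
      exact ((sub_le_sub_iff_left e).mp h₁).trans inf_le_left
  refine (hE.2 _ (by exact ⟨⟨e, he⟩, g₀, hg₀, inf_le_right⟩) hglb).2 ?_
  rintro _ ⟨x, ⟨g, hg, hx⟩, rfl⟩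
  exact (inf_le_inf_right e (hbG g hg)).trans hx

/-- The net of elements of `E ∩ [0, h]` converges in order to `h`. -/
lemma IsOrderDenseIn.orderNull_sub (hF : IsArchimedeanVL F) {E H : Submodule ℝ F}
    (hH : IsRegularSublattice H) (hd : IsOrderDenseIn E H) {h : F} (hh : h ∈ H) (h0 : 0 ≤ h) :
    OrderNull fun x : {x : F // x ∈ E ∧ 0 ≤ x ∧ x ≤ h} => h - x := by
  have hglb : IsGLB (Set.range fun x : {x : F // x ∈ E ∧ 0 ≤ x ∧ x ≤ h} =>
      (⟨h - x, H.sub_mem hh (hd.1 x.2.1)⟩ : H)) (0 : H) := by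
    constructor
    · rintro _ ⟨x, rfl⟩
      exact sub_nonneg.mpr x.2.2.2
    · rintro ⟨l, hlH⟩ hl
      have : h ≤ h - l := hd.le_of_forall_le hF hH.1 hh h0 (H.sub_mem hh hlH)
        fun x hx hx0 hxh => le_sub_comm.mp (hl ⟨⟨x, hx, hx0, hxh⟩, rfl⟩)
      exact (le_sub_self_iff h).mp this
  refine ⟨_, hH.2 _ (by exact ⟨_, ⟨0, E.zero_mem, le_rfl, h0⟩, rfl⟩) hglb, ?_⟩
  rintro _ ⟨_, ⟨x, rfl⟩, rfl⟩
  exact ⟨x, fun y hy => sub_le_sub_left (show (x : F) ≤ y from hy) h⟩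

/-- The positive and negative parts of `h` are approximated from below by separate increasing nets
in `E`; their differences converge to `h`. -/
lemma IsOrderDenseIn.subset_orderAdherence (hF : IsArchimedeanVL F) {E H : Submodule ℝ F}
    (hE : IsVectorSublattice E) (hH : IsRegularSublattice H) (hd : IsOrderDenseIn E H) :
    (H : Set F) ⊆ orderAdherence (E : Set F) := by
  intro h hh
  have hdir : ∀ f : F, IsDirectedOrder {x : F // x ∈ E ∧ 0 ≤ x ∧ x ≤ f} := fun f =>
    ⟨fun x y => ⟨⟨x ⊔ y, (hE _ x.2.1 _ y.2.1).1, x.2.2.1.trans le_sup_left,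
      sup_le x.2.2.2 y.2.2.2⟩, le_sup_left (a := (x : F)), le_sup_right (a := (x : F))⟩⟩
  have hp : h ⊔ 0 ∈ H := (hH.1 _ hh _ H.zero_mem).1
  have hn : -h ⊔ 0 ∈ H := (hH.1 _ (H.neg_mem hh) _ H.zero_mem).1
  have := hdir (h ⊔ 0)
  have := hdir (-h ⊔ 0)
  have : Nonempty {x : F // x ∈ E ∧ 0 ≤ x ∧ x ≤ h ⊔ 0} := ⟨0, E.zero_mem, le_rfl, le_sup_right⟩
  have : Nonempty {x : F // x ∈ E ∧ 0 ≤ x ∧ x ≤ -h ⊔ 0} := ⟨0, E.zero_mem, le_rfl, le_sup_right⟩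
  refine ⟨{x : F // x ∈ E ∧ 0 ≤ x ∧ x ≤ h ⊔ 0} × {x : F // x ∈ E ∧ 0 ≤ x ∧ x ≤ -h ⊔ 0},
    inferInstance, inferInstance, inferInstance, fun k => k.1 - k.2,
    fun k => E.sub_mem k.1.2.1 k.2.2.1, ?_⟩
  refine ((hd.orderNull_sub hF hH hp le_sup_right).add_prod
    (hd.orderNull_sub hF hH hn le_sup_right)).mono fun k => ?_
  have h₁ : h = h ⊔ 0 - (-h ⊔ 0) := (posPart_sub_negPart h).symm
  have h₂ : (k.1 : F) - k.2 - h = -((h ⊔ 0) - k.1) + ((-h ⊔ 0) - k.2) := by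
    calc (k.1 : F) - k.2 - h = k.1 - k.2 - (h ⊔ 0 - (-h ⊔ 0)) := congrArg _ h₁
      _ = _ := by abel
  rw [h₂]
  refine (abs_add_le _ _).trans ?_
  rw [abs_neg, abs_of_nonneg (sub_nonneg.mpr k.1.2.2.2), abs_of_nonneg (sub_nonneg.mpr k.2.2.2.2)]

end VectorLattice

theorem theorem8p1 {F : Type u} [Lattice F] [AddCommGroup F] [IsOrderedAddMonoid F]
    [Module ℝ F] [IsOrderedModule ℝ F] (hF : IsArchimedeanVL F)
    (E : Submodule ℝ F) (hE : IsRegularSublattice E) :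
    (∃ H : Submodule ℝ F, (H : Set F) = orderAdherence (E : Set F) ∧
      IsGreatest {K : Submodule ℝ F | IsRegularSublattice K ∧ IsOrderDenseIn E K} H) ∧
    orderAdherence (E : Set F) = uoAdherence (E : Set F) ∧
    IsUOClosed (orderAdherence (E : Set F)) := by
  have hU := hE.uoAdherenceSubmodule hF
  have hd := hE.isOrderDenseIn_uoAdherence
  have heq : orderAdherence (E : Set F) = uoAdherence (E : Set F) :=
    (orderAdherence_subset_uoAdherence _).antisymm (hd.subset_orderAdherence hF hE.1 hU)
  refine ⟨⟨uoAdherenceSubmodule E, heq.symm, ⟨hU, hd⟩, fun K hK => ?_⟩, heq, ?_⟩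
  · exact (hK.2.subset_orderAdherence hF hE.1 hK.1).trans heq.subset
  · rw [heq]
    refine Set.Subset.antisymm ?_ (le_uoAdherenceSubmodule (uoAdherenceSubmodule E))
    -- By transitivity `E` is order dense in the uo-adherence of its uo-adherence, which is regular,
    -- so no new limits appear.
    exact ((hd.trans hU.isOrderDenseIn_uoAdherence).subset_orderAdherence hF hE.1
      (hU.uoAdherenceSubmodule hF)).trans heq.subset
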